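/- Let $n\ge 1$, let $\lambda=(\lambda_1\ge\dots\ge\lambda_n\ge 0)$ be a partition with at most $n$ parts, and let $R=R_\lambda=\{q_1<\dots<q_r\}\subseteq\{1,\dots,n-1\}$ be the set of column lengths of its shape that are less than $n$; put $q_0=0$, $q_{r+1}=n$. The intervals $(q_{h-1},q_h]$, $1\le h\le r+1$, are the *carrels*. All tuples below are $n$-tuples with entries in $\{1,\dots,n\}$, ordered entrywise. **Tuples.** $U_\lambda(n)$ is the set of tuples $\upsilon$ with $\upsilon_i\ge i$ for all $i$; $UF_\lambda(n)$ is the set of weakly increasing $\upsilon\in U_\lambda(n)$; $UI_\lambda(n)$ is the set of $\upsilon\in U_\lambda(n)$ strictly increasing on each carrel. For $\upsilon\in U_\lambda(n)$ the *critical indices* in the carrel $(q_{h-1},q_h]$ are found from right to left: $q_h$ is critical, and after a critical index $y$ the next one is the largest $x<y$ in the carrel with $\upsilon_y-\upsilon_x>y-x$, if one exists. For an index $i$, let $x(i)$ be the smallest critical index $\ge i$. The *core* $\Delta_\lambda(\upsilon)$ has entries $\upsilon_{x(i)}-(x(i)-i)$. A tuple $\gamma\in UI_\lambda(n)$ is *gapless*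 if whenever $1\le h\le r$ and $\gamma_{q_h}>\gamma_{q_h+1}$, then with $s=\gamma_{q_h}-\gamma_{q_h+1}+1$ the next carrel $(q_h,q_{h+1}]$ has at least $s$ indices and its first $s$ entries are $\gamma_{q_h}-s+1,\dots,\gamma_{q_h}$. Let $UGC_\lambda(n)$ be the set of $\eta\in U_\lambda(n)$ whose core is gapless. For $\beta,\beta'\in U_\lambda(n)$ write $\beta\sim\beta'$ if $\{\epsilon\in UI_\lambda(n):\epsilon\le\beta\}=\{\epsilon\in UI_\lambda(n):\epsilon\le\beta'\}$. For $\eta\in UGC_\lambda(n)$ the *canopy* $\dot\eta$ has $\dot\eta_i=\eta_i$ at critical indices $i$ of $\eta$ and $\dot\eta_i=n$ elsewhere. For $\varphi\in UF_\lambda(n)$ the *ceiling* $\bar\varphi$ has $\bar\varphi_i=\varphi_{x(i)}$. The *floor* $\underline\varphi$ agrees with $\Delta_\lambda(\varphi)$, except that $\underline\varphi_i=\max\{\varphi_{q_h},\Delta_\lambda(\varphi)_i\}$ if $i$ is not critical and the largest critical index less than $i$ exists and is some $q_h$ with $1\le h\le r$. **Polynomials.** For $\beta\in U_\lambda(n)$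 let $\mathcal S_\lambda(\beta)$ be the set of semistandard tableaux of shape $\lambda$ with values in $\{1,\dots,n\}$ whose values in row $i$ are at most $\beta_i$, for every $i$. The *row bound sum* is $s_\lambda(\beta;x)=\sum_{T\in\mathcal S_\lambda(\beta)}\prod_{k=1}^n x_k^{\theta_k(T)}$, where $\theta_k(T)$ is the number of values of $T$ equal to $k$. It is called a *gapless core Schur polynomial* if $\beta\in UGC_\lambda(n)$ and a *flag Schur polynomial* if $\beta\in UF_\lambda(n)$. **Statement.** (i) Let $\beta\in U_\lambda(n)$ and $\eta\in UGC_\lambda(n)$. If $s_\lambda(\beta;x)=s_\lambda(\eta;x)$, then $\beta\sim\eta$ and $\Delta_\lambda(\beta)=\Delta_\lambda(\eta)$; hence $\beta\in UGC_\lambda(n)$ and $\mathcal S_\lambda(\beta)=\mathcal S_\lambda(\eta)$. (ii) The sets $UGC_\lambda(n)\cap[\Delta_\lambda(\eta),\dot\eta]$, $\eta\in UGC_\lambda(n)$, partition $UGC_\lambda(n)$. For each $\eta\in UGC_\lambda(n)$ this set is the $\sim$-class of $\eta$ in $UGC_\lambda(n)$, with least element $\Delta_\lambda(\eta)$ and greatest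 element $\dot\eta$. It equals the $\sim$-class of $\eta$ in $U_\lambda(n)$, which is $U_\lambda(n)\cap[\Delta_\lambda(\eta),\dot\eta]$. For $\beta\in U_\lambda(n)$ (in particular for $\beta\in UGC_\lambda(n)$) one has $s_\lambda(\beta;x)=s_\lambda(\eta;x)$ if and only if $\beta\in[\Delta_\lambda(\eta),\dot\eta]$. (iii) The sets $UF_\lambda(n)\cap[\underline\varphi,\bar\varphi]$, $\varphi\in UF_\lambda(n)$, partition $UF_\lambda(n)$, and $UF_\lambda(n)\subseteq UGC_\lambda(n)$. For each $\varphi\in UF_\lambda(n)$ the set $UF_\lambda(n)\cap[\underline\varphi,\bar\varphi]$ is the $\sim$-class of $\varphi$ in $UF_\lambda(n)$, with least element $\underline\varphi$ and greatest element $\bar\varphi$. For $\varphi'\in UF_\lambda(n)$ one has $s_\lambda(\varphi';x)=s_\lambda(\varphi;x)$ if and only if $\varphi'\in[\underline\varphi,\bar\varphi]$. -/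

import Mathlib

/-!  Conventions.  An `nn`-tuple (an `n`-tuple with entries in `{1, …, n}`) is a function
`Fin n → Fin n`, ordered entrywise; indices, tuple entries, tableau values and the rows and columns
of a shape are all numbered from `0` instead of from `1`.  Column lengths, hence also the
elements `q` of the set of dividers `R ⊆ {1, …, n - 1}`, are not shifted: a divider `q` separates
the first `q` indices `0, …, q - 1` from the indices `q, …, n - 1`. -/

noncomputable section

namespace RowBound

/-! ### Tuples with dividers -/

section Tuples

variable {n : ℕ}

/-- For `i ≤ k`: no divider lies between the indices `i` and `k`. -/
def SameCarrel (R : Set ℕ) (i k : Fin n) : Prop :=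
  ∀ q ∈ R, ¬ ((i : ℕ) < q ∧ q ≤ (k : ℕ))

/-- `x` is the rightmost index of its carrel. -/
def IsCarrelEnd (R : Set ℕ) (x : Fin n) : Prop :=
  (x : ℕ) + 1 ∈ R ∨ (x : ℕ) + 1 = n

/-- `U_R(n)`: upper tuples, `υ_i ≥ i`. -/
def U (n : ℕ) : Set (Fin n → Fin n) := {υ | ∀ i, i ≤ υ i}

/-- `UF_R(n)`: upper flags. -/
def UF (n : ℕ) : Set (Fin n → Fin n) := {φ | φ ∈ U n ∧ Monotone φ}

/-- `UI_R(n)`: upper tuples that strictly increase within each carrel. -/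
def UI (R : Set ℕ) : Set (Fin n → Fin n) :=
  {α | α ∈ U n ∧ ∀ i k, i < k → SameCarrel R i k → α i < α k}

/-- `UG_R(n)`: gapless `R`-tuples.  Here `a` is the last index of a carrel, `b` is the first index
of the next carrel, and if `γ_a > γ_b` then, with `s = γ_a - γ_b + 1`, that next carrel has at
least `s` indices and its first `s` entries are `γ_a - s + 1 = γ_b, γ_b + 1, …, γ_a`. -/
def UG (R : Set ℕ) : Set (Fin n → Fin n) :=
  {γ | γ ∈ UI R ∧ ∀ a b : Fin n, (b : ℕ) = a + 1 → (b : ℕ) ∈ R → γ b < γ a →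
    ∀ t : ℕ, t < (γ a : ℕ) - γ b + 1 →
      ∃ k : Fin n, (k : ℕ) = b + t ∧ SameCarrel R b k ∧ (γ k : ℕ) = γ b + t}

/-- The critical indices of `υ`, found in each carrel from right to left: the carrel end is
critical, and after a critical index `y` the next one is the maximal `x < y` in the same carrel
with `υ_y - υ_x > y - x`, if there is one. -/
inductive IsCritical (R : Set ℕ) (υ : Fin n → Fin n) : Fin n → Prop
  | last (x : Fin n) (hx : IsCarrelEnd R x) : IsCritical R υ x
  | next (x y : Fin n) (hy : IsCritical R υ y) (hxy : x < y) (hc : SameCarrel R x y)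
      (hgap : ((y : ℕ) : ℤ) - ((x : ℕ) : ℤ) < ((υ y : ℕ) : ℤ) - ((υ x : ℕ) : ℤ))
      (hmax : ∀ z : Fin n, x < z → z < y →
        ¬ (((y : ℕ) : ℤ) - ((z : ℕ) : ℤ) < ((υ y : ℕ) : ℤ) - ((υ z : ℕ) : ℤ))) :
      IsCritical R υ x

open Classical in
/-- The critical indices `≥ i`. -/
def criticalFrom (R : Set ℕ) (υ : Fin n → Fin n) (i : Fin n) : Finset (Fin n) :=
  Finset.univ.filter fun x => i ≤ x ∧ IsCritical R υ x

open Classical in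
/-- The critical indices `< i`. -/
def criticalBefore (R : Set ℕ) (υ : Fin n → Fin n) (i : Fin n) : Finset (Fin n) :=
  Finset.univ.filter fun x => x < i ∧ IsCritical R υ x

theorem criticalFrom_nonempty (R : Set ℕ) (υ : Fin n → Fin n) (i : Fin n) :
    (criticalFrom R υ i).Nonempty := by
  have hi := i.isLt
  refine ⟨⟨n - 1, by omega⟩, ?_⟩
  simp only [criticalFrom, Finset.mem_filter, Finset.mem_univ, true_and]
  refine ⟨?_, IsCritical.last _ (Or.inr ?_)⟩
  · rw [Fin.le_def]; simp only; omega
  · simp only; omega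

/-- The smallest critical index `x ≥ i`. -/
def nextCritical (R : Set ℕ) (υ : Fin n → Fin n) (i : Fin n) : Fin n :=
  (criticalFrom R υ i).min' (criticalFrom_nonempty R υ i)

/-- The `R`-core `Δ_R(υ)`: `δ_i = υ_x - (x - i)`, where `x` is the smallest critical index `≥ i`. -/
def core (R : Set ℕ) (υ : Fin n → Fin n) : Fin n → Fin n := fun i =>
  ⟨(υ (nextCritical R υ i) : ℕ) - ((nextCritical R υ i : ℕ) - i),
    lt_of_le_of_lt (Nat.sub_le _ _) (υ (nextCritical R υ i)).isLt⟩

/-- `UGC_R(n)`: gapless core `R`-tuples. -/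
def UGC (R : Set ℕ) : Set (Fin n → Fin n) := {η | η ∈ U n ∧ core R η ∈ UG R}

/-- `{β}_R`: the `R`-increasing upper tuples below `β`. -/
def increasingBelow (R : Set ℕ) (β : Fin n → Fin n) : Set (Fin n → Fin n) :=
  {ε | ε ∈ UI R ∧ ε ≤ β}

/-- The relation `β ∼_R β'`. -/
def Sim (R : Set ℕ) (β β' : Fin n → Fin n) : Prop :=
  increasingBelow R β = increasingBelow R β'

/-- The equivalence class of `υ` for `∼_R` restricted to the set `A` of tuples. -/
def classIn (A : Set (Fin n → Fin n)) (R : Set ℕ) (υ : Fin n → Fin n) : Set (Fin n → Fin n) :=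
  {υ' | υ' ∈ A ∧ Sim R υ' υ}

open Classical in
/-- The `R`-canopy of a gapless core tuple: keep the critical entries, and put the largest
possible entry at every other index. -/
def canopy (R : Set ℕ) (υ : Fin n → Fin n) : Fin n → Fin n := fun i =>
  if IsCritical R υ i then υ i else ⟨n - 1, Nat.sub_lt (Nat.lt_of_le_of_lt (Nat.zero_le _) i.isLt)
    Nat.zero_lt_one⟩

open Classical in
/-- The `R`-floor of an upper flag.  It keeps the critical entries.  At a non-critical index `i` it
agrees with the core, except when the last critical index `x'` before `i` exists and is the end of
an earlier carrel; then the entry is the maximum of `υ_{x'}` and the core entry. -/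
def floor (R : Set ℕ) (υ : Fin n → Fin n) : Fin n → Fin n := fun i =>
  if IsCritical R υ i then υ i
  else if h : (criticalBefore R υ i).Nonempty then
    if IsCarrelEnd R ((criticalBefore R υ i).max' h) then
      max (υ ((criticalBefore R υ i).max' h)) (core R υ i)
    else core R υ i
  else core R υ i

/-- The `R`-ceiling of an upper flag: `ξ_i = υ_x`, where `x` is the smallest critical
index `≥ i`. -/
def ceiling (R : Set ℕ) (υ : Fin n → Fin n) : Fin n → Fin n := fun i => υ (nextCritical R υ i)

/-- `c` is a partitioning of the set `A` into nonempty, pairwise disjoint blocks. -/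
def IsPartitionOf {α : Type*} (c : Set (Set α)) (A : Set α) : Prop :=
  (∀ B ∈ c, B.Nonempty) ∧ c.PairwiseDisjoint id ∧ ⋃₀ c = A

end Tuples

/-! ### Tableaux and row bound sums -/

/-- `R_λ`: the set of column lengths of the shape that are less than `n`. -/
def dividers (n : ℕ) (μ : YoungDiagram) : Set ℕ :=
  {q | q < n ∧ ∃ j, j < μ.rowLen 0 ∧ μ.colLen j = q}

/-- `𝒯_λ`: semistandard tableaux of shape `μ` with values in `{0, …, n - 1}`. -/
def tableaux (n : ℕ) (μ : YoungDiagram) : Set (SemistandardYoungTableau μ) :=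
  {T | ∀ i j, (i, j) ∈ μ → T i j < n}

theorem tableaux_finite (n : ℕ) (μ : YoungDiagram) : (tableaux n μ).Finite := by
  rw [← Set.finite_coe_iff]
  let f : tableaux n μ → (μ.cells → Fin n) := fun T c =>
    ⟨T.1 c.1.1 c.1.2, T.2 _ _ ((YoungDiagram.mem_cells _).1 c.2)⟩
  refine Finite.of_injective f ?_
  intro T T' h
  apply Subtype.ext
  apply SemistandardYoungTableau.ext
  intro i j
  by_cases hc : (i, j) ∈ μ
  · have := congrFun h ⟨(i, j), (YoungDiagram.mem_cells _).2 hc⟩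
    simpa [f] using this
  · rw [T.1.zeros hc, T'.1.zeros hc]

/-- `𝒮_λ(β)`: the tableaux whose values in row `i` are at most `β_i`. -/
def rowBoundSet {n : ℕ} (μ : YoungDiagram) (β : Fin n → Fin n) :
    Set (SemistandardYoungTableau μ) :=
  {T | T ∈ tableaux n μ ∧ ∀ (i : Fin n) (j : ℕ), ((i : ℕ), j) ∈ μ → T i j ≤ β i}

theorem rowBoundSet_finite {n : ℕ} (μ : YoungDiagram) (β : Fin n → Fin n) :
    (rowBoundSet μ β).Finite :=
  (tableaux_finite n μ).subset fun _ h => h.1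

/-- The number of boxes of `T` with value `k`. -/
def content {μ : YoungDiagram} (T : SemistandardYoungTableau μ) (k : ℕ) : ℕ :=
  (μ.cells.filter fun c => T c.1 c.2 = k).card

/-- The row bound sum `s_λ(β; x)`. -/
def rowBoundSum {n : ℕ} (μ : YoungDiagram) (β : Fin n → Fin n) : MvPolynomial (Fin n) ℤ :=
  ∑ T ∈ (rowBoundSet_finite μ β).toFinset, ∏ k : Fin n, MvPolynomial.X k ^ content T k

end RowBound

end

noncomputable section

namespace RowBound

/-! ### Carrels, and critical indices as records -/

section Carrels

variable {n : ℕ} {R : Set ℕ}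

/-! Critical indices are the strict right-to-left minima of `υ k - k` within a carrel
(`isCritical_iff`), so the core at `i` is `i` plus the minimum of `υ k - k` over the indices `k ≥ i`
of the carrel. Hence the core is the greatest element of `increasingBelow R υ` (`isGreatest_core`):
the relation `∼` is equality of cores, and having a given core is an interval condition
(`core_eq_iff_mem_Icc`), with a variant for flags.

On the tableau side, the last entries of the rows of `T` form a tuple `ε ∈ UI`, and `T` satisfies
the bounds `β` iff `ε ≤ β`. Every `ε ∈ UI` arises in this way, so sets of tableaux also correspond
to cores.

It remains to recover the set of tableaux from the polynomial when one core `γ` is gapless.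
Gaplessness provides nested column sets, hence a key tableau `Y` whose rows end in `γ` and which is
the only tableau with its content (`exists_key`). If `s(β) = s(η)` with `γ` the core of `η`, the
monomial of `Y` occurs in `s(β)`, so `Y` itself obeys `β`. Thus `γ ≤ β`, which gives `S(η) ⊆ S(β)`;
setting all variables to 1 shows that the two sets have the same size, so they coincide. -/

theorem SameCarrel.refl (i : Fin n) : SameCarrel R i i := fun q _ h => by omega

theorem SameCarrel.trans {i j k : Fin n} (h : SameCarrel R i j) (h' : SameCarrel R j k) :
    SameCarrel R i k := fun q hq hh => by
  by_cases hj : q ≤ (j : ℕ)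
  · exact h q hq ⟨hh.1, hj⟩
  · exact h' q hq ⟨by omega, hh.2⟩

theorem SameCarrel.mono {i i' k k' : Fin n} (h : SameCarrel R i k) (hi : i ≤ i') (hk : k' ≤ k) :
    SameCarrel R i' k' := fun q hq hh => by
  rw [Fin.le_def] at hi hk
  exact h q hq ⟨by omega, by omega⟩

theorem IsCarrelEnd.not_sameCarrel {x k : Fin n} (hx : IsCarrelEnd R x) (hk : x < k) :
    ¬ SameCarrel R x k := fun h => by
  rw [Fin.lt_def] at hk
  rcases hx with hx | hx
  · exact h _ hx ⟨by omega, by omega⟩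
  · have := k.isLt
    omega

/-- An index is either a carrel end or is followed by an index of the same carrel. -/
theorem isCarrelEnd_or_succ (x : Fin n) :
    IsCarrelEnd R x ∨ ∃ y : Fin n, (y : ℕ) = x + 1 ∧ SameCarrel R x y := by
  by_cases hx : IsCarrelEnd R x
  · exact Or.inl hx
  · right
    have hx' : (x : ℕ) + 1 ∉ R ∧ (x : ℕ) + 1 ≠ n := by simpa [IsCarrelEnd] using hx
    have := x.isLt
    refine ⟨⟨x + 1, by omega⟩, rfl, fun q hq hh => ?_⟩
    have : q = (x : ℕ) + 1 := by
      have := hh.1; have := hh.2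
      simp only at this
      omega
    exact hx'.1 (this ▸ hq)

/-- Two indices in different carrels are separated by a carrel end. -/
theorem exists_isCarrelEnd_between {i k : Fin n} (h : ¬ SameCarrel R i k) :
    ∃ a, i ≤ a ∧ a < k ∧ IsCarrelEnd R a := by
  simp only [SameCarrel, not_forall, not_not] at h
  obtain ⟨q, hq, h1, h2⟩ := h
  have := k.isLt
  refine ⟨⟨q - 1, by omega⟩, ?_, ?_, Or.inl ?_⟩
  · rw [Fin.le_def]; simp only; omega
  · rw [Fin.lt_def]; simp only; omega
  · simp only
    rwa [Nat.sub_add_cancel (by omega)]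

/-- A weakly right-to-left record of `k ↦ υ k - k` in a carrel. -/
def IsRecord (R : Set ℕ) (υ : Fin n → Fin n) (x : Fin n) : Prop :=
  ∀ k, x < k → SameCarrel R x k → (υ x : ℕ) + k < υ k + x

/-- If `i` is not a record, some later index of the carrel has an equal or smaller value of `υ k -
k`; jumping to it repeatedly must stop. -/
theorem exists_isRecord (υ : Fin n → Fin n) (i : Fin n) :
    ∃ k, i ≤ k ∧ SameCarrel R i k ∧ IsRecord R υ k ∧ (υ k : ℕ) + i ≤ υ i + k := by
  induction hm : n - (i : ℕ) using Nat.strong_induction_on generalizing i with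
  | _ m ih =>
    by_cases hi : IsRecord R υ i
    · exact ⟨i, le_rfl, .refl i, hi, le_rfl⟩
    · simp only [IsRecord, not_forall, not_lt] at hi
      obtain ⟨k, hk, hc, hle⟩ := hi
      have h1 := k.isLt
      rw [Fin.lt_def] at hk
      obtain ⟨l, hl, hcl, hr, hle'⟩ := ih (n - k) (by omega) k rfl
      exact ⟨l, le_trans (Fin.le_def.2 hk.le) hl, hc.trans hcl, hr, by omega⟩

-- Replaces the greedy right-to-left search by a condition on `x` alone; everything later about
-- critical indices rests on this description.
open Classical in
theorem isCritical_iff (υ : Fin n → Fin n) (x : Fin n) : IsCritical R υ x ↔ IsRecord R υ x := by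
  constructor
  · intro h
    induction h with
    | last x hx => exact fun k hk hc => absurd hc (hx.not_sameCarrel hk)
    | next x y hy hxy hc hgap hmax ih =>
      intro k hk hck
      rcases lt_trichotomy k y with h | rfl | h
      · have := hmax k hk h
        omega
      · omega
      · have := ih k h (hck.mono hxy.le le_rfl)
        omega
  · induction hm : n - (x : ℕ) using Nat.strong_induction_on generalizing x with
    | _ m ih =>
      intro hx
      rcases isCarrelEnd_or_succ (R := R) x with he | ⟨z, hz, hcz⟩
      · exact .last x he
      -- The critical index from which the search reaches `x` is the nearest record to the right of
      -- `x`. By `key`, any index strictly between has a value of `υ k - k` at least as large as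
      -- that of this record, so the search does not stop there.
      · let A : Finset (Fin n) :=
          Finset.univ.filter fun k => x < k ∧ SameCarrel R x k ∧ IsRecord R υ k
        have key : ∀ w, x < w → SameCarrel R x w → ∃ k ∈ A, w ≤ k ∧ (υ k : ℕ) + w ≤ υ w + k := by
          intro w hw hcw
          obtain ⟨k, h1, h2, h3, h4⟩ := exists_isRecord (R := R) υ w
          exact ⟨k, by simp [A, lt_of_lt_of_le hw h1, hcw.trans h2, h3], h1, h4⟩
        have hA : A.Nonempty := by
          obtain ⟨k, hk, -⟩ := key z (Fin.lt_def.2 (by omega)) hcz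
          exact ⟨k, hk⟩
        obtain ⟨hxy, hc, hy⟩ : x < A.min' hA ∧ SameCarrel R x (A.min' hA) ∧
            IsRecord R υ (A.min' hA) := by
          simpa [A] using A.min'_mem hA
        have hgap := hx _ hxy hc
        have := (A.min' hA).isLt
        refine .next x (A.min' hA) (ih _ ?_ _ rfl hy) hxy hc (by omega) fun w hw hwy => ?_
        · rw [Fin.lt_def] at hxy
          omega
        · obtain ⟨k, hk, hwk, hle⟩ := key w hw (hc.mono le_rfl hwy.le)
          rcases (A.min'_le k hk).eq_or_lt with h | h
          · rw [h]
            omega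
          · have hk' : x < k ∧ SameCarrel R x k ∧ IsRecord R υ k := by simpa [A] using hk
            have := hy k h (hk'.2.1.mono hxy.le le_rfl)
            omega

variable (R) in
theorem le_nextCritical (υ : Fin n → Fin n) (i : Fin n) : i ≤ nextCritical R υ i := by
  have := Finset.min'_mem _ (criticalFrom_nonempty R υ i)
  simp only [criticalFrom, Finset.mem_filter] at this
  exact this.2.1

variable (R) in
theorem isCritical_nextCritical (υ : Fin n → Fin n) (i : Fin n) :
    IsCritical R υ (nextCritical R υ i) := by
  have := Finset.min'_mem _ (criticalFrom_nonempty R υ i)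
  simp only [criticalFrom, Finset.mem_filter] at this
  exact this.2.2

theorem nextCritical_le {υ : Fin n → Fin n} {i x : Fin n} (hi : i ≤ x) (hx : IsCritical R υ x) :
    nextCritical R υ i ≤ x :=
  Finset.min'_le _ _ (by simp [criticalFrom, hi, hx])

variable (R) in
theorem sameCarrel_nextCritical (υ : Fin n → Fin n) (i : Fin n) :
    SameCarrel R i (nextCritical R υ i) := by
  obtain ⟨k, h1, h2, h3, -⟩ := exists_isRecord (R := R) υ i
  exact h2.mono le_rfl (nextCritical_le h1 ((isCritical_iff υ k).2 h3))

theorem nextCritical_eq_self {υ : Fin n → Fin n} {i : Fin n} (hi : IsCritical R υ i) :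
    nextCritical R υ i = i :=
  le_antisymm (nextCritical_le le_rfl hi) (le_nextCritical R υ i)

/-- The next critical index minimises `υ k - k` over the rest of the carrel: each such `k` is
dominated by a record at or after `k`, and records only grow to the right. -/
theorem nextCritical_gap_le {υ : Fin n → Fin n} {i k : Fin n} (hi : i ≤ k)
    (hc : SameCarrel R i k) :
    (υ (nextCritical R υ i) : ℕ) + k ≤ υ k + nextCritical R υ i := by
  obtain ⟨l, h1, h2, h3, h4⟩ := exists_isRecord (R := R) υ k
  have hl := nextCritical_le (hi.trans h1) ((isCritical_iff υ l).2 h3)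
  rcases hl.eq_or_lt with h | h
  · rw [h]
    omega
  · have := (isCritical_iff υ _).1 (isCritical_nextCritical R υ i) l h
      ((hc.trans h2).mono (le_nextCritical R υ i) le_rfl)
    omega

end Carrels

/-! ### The core as greatest increasing tuple, and the interval of tuples sharing it -/

section Core

variable {n : ℕ} {R : Set ℕ} {υ : Fin n → Fin n}

/-- For an upper tuple `υ_x ≥ x`, so the natural subtraction defining the core never truncates. -/
theorem core_add_nextCritical (hυ : υ ∈ U n) (i : Fin n) :
    (core R υ i : ℕ) + nextCritical R υ i = υ (nextCritical R υ i) + i := by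
  have h1 := Fin.le_def.1 (hυ (nextCritical R υ i))
  have h2 := Fin.le_def.1 (le_nextCritical R υ i)
  simp only [core]
  omega

theorem core_add_le (hυ : υ ∈ U n) {i k : Fin n} (hi : i ≤ k) (hc : SameCarrel R i k) :
    (core R υ i : ℕ) + k ≤ υ k + i := by
  have := core_add_nextCritical (R := R) hυ i
  have := nextCritical_gap_le (υ := υ) hi hc
  omega

theorem core_le (hυ : υ ∈ U n) : core R υ ≤ υ := fun i => by
  have := core_add_le hυ le_rfl (SameCarrel.refl (R := R) i)
  rw [Fin.le_def]
  omega

theorem core_eq_of_isCritical {i : Fin n} (hi : IsCritical R υ i) : core R υ i = υ i := by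
  apply Fin.ext
  simp [core, nextCritical_eq_self hi]

theorem core_mem_UI (hυ : υ ∈ U n) : core R υ ∈ UI R := by
  refine ⟨fun i => ?_, fun i k hik hc => ?_⟩
  · have := core_add_nextCritical (R := R) hυ i
    have := Fin.le_def.1 (hυ (nextCritical R υ i))
    rw [Fin.le_def]
    omega
  · have := core_add_nextCritical (R := R) hυ k
    have := core_add_le hυ (hik.le.trans (le_nextCritical R υ k))
      (hc.trans (sameCarrel_nextCritical R υ k))
    rw [Fin.lt_def] at hik ⊢
    omega

/-- A strictly increasing integer sequence gains at least 1 per step, so `ε k - k` is weakly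
increasing on a carrel. -/
theorem add_le_of_mem_UI {ε : Fin n → Fin n} (hε : ε ∈ UI R) {i k : Fin n} (hi : i ≤ k)
    (hc : SameCarrel R i k) : (ε i : ℕ) + k ≤ ε k + i := by
  induction hm : (k : ℕ) - i generalizing i with
  | zero =>
    have : i = k := le_antisymm hi (Fin.le_def.2 (by omega))
    rw [this]
  | succ m ih =>
    have h1 : i < k := Fin.lt_def.2 (by omega)
    have h2 := k.isLt
    have hi' : (⟨i + 1, by omega⟩ : Fin n) ≤ k := Fin.le_def.2 (by simp only; omega)
    have hii : i < (⟨i + 1, by omega⟩ : Fin n) := Fin.lt_def.2 (by simp)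
    have := ih hi' (hc.mono hii.le le_rfl) (by simp only; omega)
    have := Fin.lt_def.1 (hε.2 i _ hii (hc.mono le_rfl hi'))
    simp only at *
    omega

theorem le_core (hυ : υ ∈ U n) {ε : Fin n → Fin n} (hε : ε ∈ UI R) (h : ε ≤ υ) :
    ε ≤ core R υ := fun i => by
  have := add_le_of_mem_UI hε (le_nextCritical R υ i) (sameCarrel_nextCritical R υ i)
  have := core_add_nextCritical (R := R) hυ i
  have := Fin.le_def.1 (h (nextCritical R υ i))
  rw [Fin.le_def]
  omega

theorem isGreatest_core (hυ : υ ∈ U n) : IsGreatest (increasingBelow R υ) (core R υ) :=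
  ⟨⟨core_mem_UI hυ, core_le hυ⟩, fun _ h => le_core hυ h.1 h.2⟩

theorem increasingBelow_eq (hυ : υ ∈ U n) :
    increasingBelow R υ = {ε | ε ∈ UI R ∧ ε ≤ core R υ} :=
  Set.ext fun _ => ⟨fun h => ⟨h.1, le_core hυ h.1 h.2⟩, fun h => ⟨h.1, h.2.trans (core_le hυ)⟩⟩

theorem sim_iff {υ' : Fin n → Fin n} (hυ : υ ∈ U n) (hυ' : υ' ∈ U n) :
    Sim R υ υ' ↔ core R υ = core R υ' := by
  constructor
  · intro h
    have h1 := isGreatest_core (R := R) hυ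
    rw [show increasingBelow R υ = increasingBelow R υ' from h] at h1
    exact h1.unique (isGreatest_core hυ')
  · intro h
    rw [Sim, increasingBelow_eq hυ, increasingBelow_eq hυ', h]

theorem core_eq_self (hυ : υ ∈ UI R) : core R υ = υ :=
  le_antisymm (core_le hυ.1) (le_core hυ.1 hυ le_rfl)

theorem isCritical_core_iff (hυ : υ ∈ U n) (x : Fin n) :
    IsCritical R (core R υ) x ↔ IsCritical R υ x := by
  constructor
  · intro h
    have h' := (isCritical_iff _ _).1 h
    rcases (le_nextCritical R υ x).eq_or_lt with hx | hx
    · rw [hx]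
      exact isCritical_nextCritical R υ x
    · have h1 := h' _ hx (sameCarrel_nextCritical R υ x)
      have h2 := core_add_nextCritical (R := R) hυ x
      rw [core_eq_of_isCritical (isCritical_nextCritical R υ x)] at h1
      omega
  · intro h
    have h' := (isCritical_iff _ _).1 h
    refine (isCritical_iff _ _).2 fun k hk hc => ?_
    have h1 := h' _ (hk.trans_le (le_nextCritical R υ k)) (hc.trans (sameCarrel_nextCritical R υ k))
    have h2 := core_add_nextCritical (R := R) hυ k
    rw [core_eq_of_isCritical h]
    omega

variable {υ' : Fin n → Fin n}

theorem isCritical_congr (hυ : υ ∈ U n) (hυ' : υ' ∈ U n) (h : core R υ = core R υ') (x : Fin n) :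
    IsCritical R υ x ↔ IsCritical R υ' x := by
  rw [← isCritical_core_iff hυ, h, isCritical_core_iff hυ']

theorem eq_of_isCritical (hυ : υ ∈ U n) (hυ' : υ' ∈ U n) (h : core R υ = core R υ') {x : Fin n}
    (hx : IsCritical R υ' x) : υ x = υ' x := by
  rw [← core_eq_of_isCritical hx, ← h,
    core_eq_of_isCritical ((isCritical_congr hυ hυ' h x).2 hx)]

/-- Off the critical indices the canopy takes the largest available value and imposes nothing. -/
theorem le_canopy_iff : υ' ≤ canopy R υ ↔ ∀ i, IsCritical R υ i → υ' i ≤ υ i := by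
  refine forall_congr' fun i => ?_
  by_cases hi : IsCritical R υ i
  · simp [canopy, hi]
  · have := (υ' i).isLt
    simp only [canopy, hi, if_false, false_imp_iff, iff_true, Fin.le_def]
    omega

/-- Having the same core as `υ` is an interval condition. -/
theorem core_eq_iff_mem_Icc (hυ : υ ∈ U n) (hυ' : υ' ∈ U n) :
    core R υ' = core R υ ↔ υ' ∈ Set.Icc (core R υ) (canopy R υ) := by
  constructor
  · intro h
    exact ⟨h ▸ core_le hυ', le_canopy_iff.2 fun i hi => (eq_of_isCritical hυ' hυ h hi).le⟩
  · rintro ⟨h1, h2⟩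
    -- The lower bound puts `core R υ` below the greatest increasing tuple under `υ'`. The upper
    -- bound matters only at the critical index of `υ` after `i`, where `υ'` caps its own core at
    -- `i`.
    refine le_antisymm (fun i => ?_) (le_core hυ' (core_mem_UI hυ) h1)
    have h3 := core_add_le hυ' (le_nextCritical R υ i) (sameCarrel_nextCritical R υ i)
    have h4 := Fin.le_def.1 (le_canopy_iff.1 h2 _ (isCritical_nextCritical R υ i))
    have h5 := core_add_nextCritical (R := R) hυ i
    rw [Fin.le_def]
    omega

theorem le_canopy_self : υ ≤ canopy R υ := le_canopy_iff.2 fun _ _ => le_rfl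

theorem canopy_mem_U (hυ : υ ∈ U n) : canopy R υ ∈ U n := fun i => (hυ i).trans (le_canopy_self i)

theorem core_core (hυ : υ ∈ U n) : core R (core R υ) = core R υ := core_eq_self (core_mem_UI hυ)

theorem core_canopy (hυ : υ ∈ U n) : core R (canopy R υ) = core R υ :=
  (core_eq_iff_mem_Icc hυ (canopy_mem_U hυ)).2 ⟨(core_le hυ).trans le_canopy_self, le_rfl⟩

theorem classIn_eq {A : Set (Fin n → Fin n)} (hA : A ⊆ U n) (hυ : υ ∈ U n) :
    classIn A R υ = {υ' | υ' ∈ A ∧ core R υ' = core R υ} :=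
  Set.ext fun _ => and_congr_right fun h => sim_iff (hA h) hυ

/-- The fibres of a map over a set partition the set. -/
theorem isPartitionOf_fibers {α β : Type*} (A : Set α) (f : α → β) (c : α → Set α)
    (hc : ∀ a ∈ A, c a = {a' | a' ∈ A ∧ f a' = f a}) :
    IsPartitionOf {B | ∃ a ∈ A, B = c a} A := by
  refine ⟨?_, ?_, ?_⟩
  · rintro B ⟨a, ha, rfl⟩
    exact ⟨a, by simp [hc a ha, ha]⟩
  · rintro B ⟨a, ha, rfl⟩ B' ⟨a', ha', rfl⟩ hne
    refine Set.disjoint_left.2 fun x hx hx' => hne ?_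
    simp only [id, hc a ha, hc a' ha', Set.mem_ofPred_eq] at hx hx' ⊢
    rw [← hx.2, ← hx'.2]
  · ext x
    constructor
    · rintro ⟨B, ⟨a, ha, rfl⟩, hx⟩
      rw [hc a ha] at hx
      exact hx.1
    · exact fun hx => ⟨c x, ⟨x, hx, rfl⟩, by simp [hc x hx, hx]⟩

end Core

/-! ### Upper flags: gaplessness, ceiling and floor -/

section Flags

variable {n : ℕ} {R : Set ℕ} {φ : Fin n → Fin n}

/-- From the start `b` of the next carrel up to its first critical index `x`, the core runs through
consecutive values ending at `φ_x`. Monotonicity gives `φ_x ≥ φ_a`, so this run contains all values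
from the core entry at `b` up to `φ_a`. -/
theorem core_mem_UG_of_mem_UF (hφ : φ ∈ UF n) : core R φ ∈ UG R := by
  refine ⟨core_mem_UI hφ.1, fun a b hab hb hlt t ht => ?_⟩
  have ha : IsCritical R φ a := .last a (Or.inl (hab ▸ hb))
  rw [core_eq_of_isCritical ha] at ht
  have h1 := core_add_nextCritical (R := R) hφ.1 b
  have h2 := le_nextCritical R φ b
  have h3 := Fin.le_def.1 (hφ.2 (show a ≤ nextCritical R φ b from
    le_trans (Fin.le_def.2 (by omega)) h2))
  have h4 := sameCarrel_nextCritical R φ b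
  rw [Fin.le_def] at h2
  have h5 := (nextCritical R φ b).isLt
  have hbk : b ≤ (⟨b + t, by omega⟩ : Fin n) := Fin.le_def.2 (by simp)
  have hkx : (⟨b + t, by omega⟩ : Fin n) ≤ nextCritical R φ b :=
    Fin.le_def.2 (by simp only; omega)
  refine ⟨⟨b + t, by omega⟩, rfl, h4.mono le_rfl hkx, ?_⟩
  have h6 := core_add_le hφ.1 hkx (h4.mono hbk le_rfl)
  have h7 := add_le_of_mem_UI (core_mem_UI (R := R) hφ.1) hbk (h4.mono le_rfl hkx)
  simp only at h6 h7 ⊢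
  omega

theorem mem_UGC_of_mem_UF (hφ : φ ∈ UF n) : φ ∈ UGC R := ⟨hφ.1, core_mem_UG_of_mem_UF hφ⟩

theorem le_ceiling (hφ : φ ∈ UF n) : φ ≤ ceiling R φ := fun i => hφ.2 (le_nextCritical R φ i)

theorem ceiling_mem_UF (hφ : φ ∈ UF n) : ceiling R φ ∈ UF n :=
  ⟨fun i => (hφ.1 i).trans (le_ceiling hφ i), fun _ k hik => hφ.2 <|
    nextCritical_le (hik.trans (le_nextCritical R φ k)) (isCritical_nextCritical R φ k)⟩

theorem core_ceiling (hφ : φ ∈ UF n) : core R (ceiling R φ) = core R φ :=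
  (core_eq_iff_mem_Icc hφ.1 (ceiling_mem_UF hφ).1).2
    ⟨(core_le hφ.1).trans (le_ceiling hφ), le_canopy_iff.2 fun i hi => by
      rw [ceiling, nextCritical_eq_self hi]⟩

theorem le_ceiling_of_core_eq {φ' : Fin n → Fin n} (hφ : φ ∈ UF n) (hφ' : φ' ∈ UF n)
    (h : core R φ' = core R φ) : φ' ≤ ceiling R φ := fun i => by
  rw [ceiling, ← eq_of_isCritical hφ'.1 hφ.1 h (isCritical_nextCritical R φ i)]
  exact hφ'.2 (le_nextCritical R φ i)

theorem floor_eq_of_isCritical {i : Fin n} (hi : IsCritical R φ i) : floor R φ i = φ i := by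
  simp [floor, hi]

theorem core_le_floor (φ : Fin n → Fin n) : core R φ ≤ floor R φ := fun i => by
  by_cases hi : IsCritical R φ i
  · rw [floor_eq_of_isCritical hi, core_eq_of_isCritical hi]
  · simp only [floor, hi, if_false]
    split_ifs
    · exact le_max_right _ _
    · exact le_rfl
    · exact le_rfl

/-- The floor is at most any value bounding the core and the earlier carrel end entries. -/
theorem floor_le {i v : Fin n} (hv : core R φ i ≤ v)
    (h : ∀ a, a < i → IsCarrelEnd R a → φ a ≤ v) : floor R φ i ≤ v := by
  by_cases hi : IsCritical R φ i
  · rwa [floor_eq_of_isCritical hi, ← core_eq_of_isCritical hi]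
  · simp only [floor, hi, if_false]
    split_ifs with h1 h2
    · refine max_le (h _ ?_ h2) hv
      have := Finset.max'_mem _ h1
      simp only [criticalBefore, Finset.mem_filter] at this
      exact this.2.1
    · exact hv
    · exact hv

/-- With `core_le_floor` and `floor_le`, this identifies the floor at `i` as the maximum of the core
entry and all `φ_a` at carrel ends `a < i`. When the last critical index before `i` is not a carrel
end, it shares the carrel of `i`, and the growth of the core already gives the bound. -/
theorem le_floor_of_isCarrelEnd (hφ : φ ∈ UF n) {a i : Fin n} (hai : a < i)
    (ha : IsCarrelEnd R a) : φ a ≤ floor R φ i := by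
  by_cases hi : IsCritical R φ i
  · rw [floor_eq_of_isCritical hi]
    exact hφ.2 hai.le
  · have hmem : a ∈ criticalBefore R φ i := by
      simp [criticalBefore, hai, IsCritical.last (υ := φ) a ha]
    have hne : (criticalBefore R φ i).Nonempty := ⟨a, hmem⟩
    have hle : φ a ≤ φ ((criticalBefore R φ i).max' hne) := hφ.2 (Finset.le_max' _ _ hmem)
    obtain ⟨hlt, hcr⟩ : (criticalBefore R φ i).max' hne < i ∧
        IsCritical R φ ((criticalBefore R φ i).max' hne) := by
      have := Finset.max'_mem _ hne
      simpa only [criticalBefore, Finset.mem_filter, Finset.mem_univ, true_and] using this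
    refine hle.trans ?_
    by_cases hend : IsCarrelEnd R ((criticalBefore R φ i).max' hne)
    · simp only [floor, hi, if_false, hne, hend, dif_pos, if_true]
      exact le_max_left _ _
    · refine le_trans ?_ (core_le_floor φ i)
      have hsame : SameCarrel R ((criticalBefore R φ i).max' hne) i := by
        by_contra hns
        obtain ⟨e, he1, he2, he3⟩ := exists_isCarrelEnd_between hns
        have : e ≤ (criticalBefore R φ i).max' hne := Finset.le_max' _ _ (by
          simp [criticalBefore, he2, IsCritical.last (υ := φ) e he3])
        exact hend (le_antisymm he1 this ▸ he3)
      rw [← core_eq_of_isCritical hcr]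
      exact ((core_mem_UI hφ.1).2 _ _ hlt hsame).le

theorem floor_mem_UF (hφ : φ ∈ UF n) : floor R φ ∈ UF n := by
  refine ⟨fun i => ((core_mem_UI (R := R) hφ.1).1 i).trans (core_le_floor φ i), fun i k hik => ?_⟩
  refine floor_le ?_ fun a hai ha => le_floor_of_isCarrelEnd hφ (hai.trans_le hik) ha
  rcases hik.eq_or_lt with rfl | hlt
  · exact core_le_floor φ i
  by_cases hc : SameCarrel R i k
  · exact ((core_mem_UI hφ.1).2 _ _ hlt hc).le.trans (core_le_floor φ k)
  · obtain ⟨a, h1, h2, h3⟩ := exists_isCarrelEnd_between hc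
    exact (core_le hφ.1 i).trans ((hφ.2 h1).trans (le_floor_of_isCarrelEnd hφ h2 h3))

theorem core_floor (hφ : φ ∈ UF n) : core R (floor R φ) = core R φ :=
  (core_eq_iff_mem_Icc hφ.1 (floor_mem_UF hφ).1).2
    ⟨core_le_floor φ, le_canopy_iff.2 fun _ hi => (floor_eq_of_isCritical hi).le⟩

theorem floor_le_of_core_eq {φ' : Fin n → Fin n} (hφ : φ ∈ UF n) (hφ' : φ' ∈ UF n)
    (h : core R φ' = core R φ) : floor R φ ≤ φ' := fun i =>
  floor_le (h ▸ core_le hφ'.1 i) fun a hai ha => by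
    rw [← eq_of_isCritical hφ'.1 hφ.1 h (.last a ha)]
    exact hφ'.2 hai.le

theorem core_eq_iff_mem_Icc_of_mem_UF {φ' : Fin n → Fin n} (hφ : φ ∈ UF n) (hφ' : φ' ∈ UF n) :
    core R φ' = core R φ ↔ φ' ∈ Set.Icc (floor R φ) (ceiling R φ) := by
  refine ⟨fun h => ⟨floor_le_of_core_eq hφ hφ' h, le_ceiling_of_core_eq hφ hφ' h⟩, fun h => ?_⟩
  refine (core_eq_iff_mem_Icc hφ.1 hφ'.1).2 ⟨(core_le_floor φ).trans h.1, le_canopy_iff.2 ?_⟩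
  intro i hi
  have := h.2 i
  rwa [ceiling, nextCritical_eq_self hi] at this

end Flags

/-! ### Tableaux and the tuples of their row ends -/

section Shape

variable {n : ℕ} {μ : YoungDiagram}

theorem mem_dividers_iff {q : ℕ} : q ∈ dividers n μ ↔ q < n ∧ 0 < q ∧ ∃ j, μ.colLen j = q := by
  constructor
  · rintro ⟨h1, j, hj, rfl⟩
    exact ⟨h1, YoungDiagram.mem_iff_lt_colLen.1 (YoungDiagram.mem_iff_lt_rowLen.2 hj), j, rfl⟩
  · rintro ⟨h1, h2, j, rfl⟩
    exact ⟨h1, j, YoungDiagram.mem_iff_lt_rowLen.1 (YoungDiagram.mem_iff_lt_colLen.2 h2), rfl⟩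

/-- Two rows lie in the same carrel if and only if they have the same length. -/
theorem sameCarrel_iff_rowLen {i k : Fin n} (hik : i ≤ k) :
    SameCarrel (dividers n μ) i k ↔ μ.rowLen i = μ.rowLen k := by
  have hle := μ.rowLen_anti i k hik
  have hk := k.isLt
  constructor
  · intro h
    by_contra hne
    have h1 : (↑i, μ.rowLen k) ∈ μ := YoungDiagram.mem_iff_lt_rowLen.2 (by omega)
    have h2 : (↑k, μ.rowLen k) ∉ μ := fun h => lt_irrefl _ (YoungDiagram.mem_iff_lt_rowLen.1 h)
    rw [YoungDiagram.mem_iff_lt_colLen] at h1 h2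
    exact h _ (mem_dividers_iff.2 ⟨by omega, by omega, _, rfl⟩) ⟨h1, by omega⟩
  · rintro h q hq ⟨h1, h2⟩
    obtain ⟨-, -, j, rfl⟩ := mem_dividers_iff.1 hq
    rw [← YoungDiagram.mem_iff_lt_colLen, YoungDiagram.mem_iff_lt_rowLen, h,
      ← YoungDiagram.mem_iff_lt_rowLen, YoungDiagram.mem_iff_lt_colLen] at h1
    omega

/-- Every column of the shape ends at the end of a carrel. -/
theorem exists_isCarrelEnd_of_mem (hμ : μ.colLen 0 ≤ n) {i j : ℕ} (h : (i, j) ∈ μ) :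
    ∃ x : Fin n, (x : ℕ) + 1 = μ.colLen j ∧ i ≤ x ∧ IsCarrelEnd (dividers n μ) x := by
  have h1 := YoungDiagram.mem_iff_lt_colLen.1 h
  have h2 := μ.colLen_anti 0 j (Nat.zero_le _)
  have h3 : μ.colLen j - 1 + 1 = μ.colLen j := by omega
  refine ⟨⟨μ.colLen j - 1, by omega⟩, h3, by simp only; omega, ?_⟩
  simp only [IsCarrelEnd, h3]
  rcases (h2.trans hμ).lt_or_eq with hlt | heq
  · exact Or.inl (mem_dividers_iff.2 ⟨hlt, by omega, j, rfl⟩)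
  · exact Or.inr heq

theorem lt_of_mem (hμ : μ.colLen 0 ≤ n) {i j : ℕ} (h : (i, j) ∈ μ) : i < n :=
  (YoungDiagram.mem_iff_lt_colLen.1 h).trans_le ((μ.colLen_anti 0 j (Nat.zero_le _)).trans hμ)

theorem rowEnd_mem {i : ℕ} (h : 0 < μ.rowLen i) : (i, μ.rowLen i - 1) ∈ μ :=
  YoungDiagram.mem_iff_lt_rowLen.2 (by omega)

/-- At an index without boxes an increasing upper tuple takes the least possible value. -/
theorem eq_self_of_rowLen_eq_zero {ε : Fin n → Fin n} (hε : ε ∈ UI (dividers n μ)) {i : Fin n}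
    (hi : μ.rowLen i = 0) : ε i = i := by
  have h1 := i.isLt
  have hle : i ≤ (⟨n - 1, by omega⟩ : Fin n) := Fin.le_def.2 (by simp only; omega)
  have h2 : SameCarrel (dividers n μ) i ⟨n - 1, by omega⟩ := by
    have := μ.rowLen_anti i (n - 1) (by omega)
    exact (sameCarrel_iff_rowLen hle).2 (by simp only; omega)
  have h3 := add_le_of_mem_UI hε hle h2
  have h4 := (ε ⟨n - 1, by omega⟩).isLt
  have h5 := Fin.le_def.1 (hε.1 i)
  apply Fin.ext
  simp only at h3
  omega

theorem le_entry (T : SemistandardYoungTableau μ) {i j : ℕ} (h : (i, j) ∈ μ) : i ≤ T i j := by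
  induction i with
  | zero => exact Nat.zero_le _
  | succ i ih =>
    have := ih (μ.up_left_mem (Nat.le_succ i) le_rfl h)
    have := T.col_strict (Nat.lt_add_one i) h
    omega

/-- A tableau whose rows end with the entries of `ε` satisfies the row bounds above `ε`. -/
theorem mem_rowBoundSet_iff {T : SemistandardYoungTableau μ} (hT : T ∈ tableaux n μ)
    {ε : Fin n → Fin n} (hε : ε ∈ UI (dividers n μ))
    (h : ∀ i : Fin n, 0 < μ.rowLen i → T i (μ.rowLen i - 1) = ε i)
    {β : Fin n → Fin n} (hβ : β ∈ U n) : T ∈ rowBoundSet μ β ↔ ε ≤ β := by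
  constructor
  · rintro ⟨-, hb⟩ i
    rcases Nat.eq_zero_or_pos (μ.rowLen i) with hi | hi
    · rw [eq_self_of_rowLen_eq_zero hε hi]
      exact hβ i
    · rw [Fin.le_def, ← h i hi]
      exact hb i _ (rowEnd_mem hi)
  · intro hle
    refine ⟨hT, fun i j hij => ?_⟩
    have hj := YoungDiagram.mem_iff_lt_rowLen.1 hij
    have hi : 0 < μ.rowLen i := by omega
    calc T i j ≤ T i (μ.rowLen i - 1) := T.row_weak_of_le (by omega) (rowEnd_mem hi)
      _ = ε i := h i hi
      _ ≤ β i := hle i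

/-- The largest entry of a row is its last one, and rows in one carrel end in the same column, where
entries strictly increase. Empty rows receive the minimal value `i`, which every upper tuple bounds.
-/
theorem exists_rowEnds {T : SemistandardYoungTableau μ} (hT : T ∈ tableaux n μ) :
    ∃ ε ∈ UI (n := n) (dividers n μ), ∀ β ∈ U n, T ∈ rowBoundSet μ β ↔ ε ≤ β := by
  let ε : Fin n → Fin n := fun i =>
    if h : 0 < μ.rowLen i then ⟨T i (μ.rowLen i - 1), hT _ _ (rowEnd_mem h)⟩ else i
  have hε1 : ∀ i : Fin n, 0 < μ.rowLen i → T i (μ.rowLen i - 1) = ε i := fun i hi => by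
    simp [ε, hi]
  have hε : ε ∈ UI (dividers n μ) := by
    refine ⟨fun i => ?_, fun i k hik hc => ?_⟩
    · by_cases hi : 0 < μ.rowLen i
      · rw [Fin.le_def, ← hε1 i hi]
        exact le_entry T (rowEnd_mem hi)
      · simp [ε, hi]
    · have hr := (sameCarrel_iff_rowLen hik.le).1 hc
      by_cases hi : 0 < μ.rowLen i
      · have hk := hr ▸ hi
        rw [Fin.lt_def, ← hε1 i hi, ← hε1 k hk, hr]
        exact T.col_strict hik (rowEnd_mem hk)
      · have hk := hr ▸ hi
        simp [ε, hi, hk, hik]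
  exact ⟨ε, hε, fun β hβ => mem_rowBoundSet_iff hT hε hε1 hβ⟩

/-- Fill row `i` with the value `i`, except for `ε i` in its last box. Two last boxes in one column
belong to rows of equal length, hence of one carrel, where `ε` strictly increases. -/
theorem exists_tableau_of_mem_UI (hμ : μ.colLen 0 ≤ n) {ε : Fin n → Fin n}
    (hε : ε ∈ UI (dividers n μ)) :
    ∃ T : SemistandardYoungTableau μ, ∀ β ∈ U n, T ∈ rowBoundSet μ β ↔ ε ≤ β := by
  have hle : ∀ i (hi : i < n), i ≤ ε ⟨i, hi⟩ := fun i hi => Fin.le_def.1 (hε.1 ⟨i, hi⟩)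
  let e : ℕ → ℕ → ℕ := fun i j =>
    if h : (i, j) ∈ μ then if j + 1 = μ.rowLen i then ε ⟨i, lt_of_mem hμ h⟩ else i else 0
  have he : ∀ i j (h : (i, j) ∈ μ),
      e i j = if j + 1 = μ.rowLen i then (ε ⟨i, lt_of_mem hμ h⟩ : ℕ) else i := fun i j h => by
    simp [e, h]
  let T : SemistandardYoungTableau μ :=
    { entry := e
      row_weak' := by
        intro i j1 j2 hj h
        have h' := μ.up_left_mem le_rfl hj.le h
        have := YoungDiagram.mem_iff_lt_rowLen.1 h
        have := hle i (lt_of_mem hμ h)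
        rw [he _ _ h, he _ _ h', if_neg (by omega)]
        split_ifs <;> omega
      col_strict' := by
        intro i1 i2 j hi h
        have h' := μ.up_left_mem hi.le le_rfl h
        have h1 := YoungDiagram.mem_iff_lt_rowLen.1 h
        have h2 := μ.rowLen_anti i1 i2 hi.le
        have h3 := hle i2 (lt_of_mem hμ h)
        rw [he _ _ h, he _ _ h']
        by_cases hj2 : j + 1 = μ.rowLen i2
        · rw [if_pos hj2]
          by_cases hj1 : j + 1 = μ.rowLen i1
          · rw [if_pos hj1]
            refine hε.2 _ _ (Fin.lt_def.2 hi) ((sameCarrel_iff_rowLen (Fin.le_def.2 hi.le)).2 ?_)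
            simp only
            omega
          · rw [if_neg hj1]
            omega
        · rw [if_neg hj2, if_neg (by omega)]
          exact hi
      zeros' := fun h => by simp [e, h] }
  have hT : T ∈ tableaux n μ := fun i j h => by
    change e i j < n
    rw [he _ _ h]
    have := lt_of_mem hμ h
    have := (ε ⟨i, lt_of_mem hμ h⟩).isLt
    split_ifs <;> omega
  refine ⟨T, fun β hβ => mem_rowBoundSet_iff hT hε (fun i hi => ?_) hβ⟩
  change e i (μ.rowLen i - 1) = ε i
  rw [he _ _ (rowEnd_mem hi), if_pos (by omega)]

theorem rowBoundSet_subset {β β' : Fin n → Fin n} (hβ : β ∈ U n) (hβ' : β' ∈ U n)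
    (h : core (dividers n μ) β ≤ β') : rowBoundSet μ β ⊆ rowBoundSet μ β' := fun T hT => by
  obtain ⟨ε, hε, hiff⟩ := exists_rowEnds hT.1
  exact (hiff β' hβ').2 ((le_core hβ hε ((hiff β hβ).1 hT)).trans h)

theorem rowBoundSet_eq_of_core_eq {β β' : Fin n → Fin n} (hβ : β ∈ U n) (hβ' : β' ∈ U n)
    (h : core (dividers n μ) β = core (dividers n μ) β') : rowBoundSet μ β = rowBoundSet μ β' :=
  (rowBoundSet_subset hβ hβ' (h ▸ core_le hβ')).antisymm
    (rowBoundSet_subset hβ' hβ (h ▸ core_le hβ))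

theorem sim_of_rowBoundSet_eq (hμ : μ.colLen 0 ≤ n) {β β' : Fin n → Fin n} (hβ : β ∈ U n)
    (hβ' : β' ∈ U n) (h : rowBoundSet μ β = rowBoundSet μ β') : Sim (dividers n μ) β β' := by
  refine Set.ext fun ε => and_congr_right fun hε => ?_
  obtain ⟨T, hT⟩ := exists_tableau_of_mem_UI hμ hε
  rw [← hT β hβ, ← hT β' hβ', h]

end Shape

/-! ### Contents, column sets and coefficients -/

section Content

variable {n : ℕ} {μ : YoungDiagram}

/-- The set of values in column `j`. -/
def colSet (T : SemistandardYoungTableau μ) (j : ℕ) : Finset ℕ :=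
  (Finset.range (μ.colLen j)).image fun i => T i j

theorem col_injOn (T : SemistandardYoungTableau μ) (j : ℕ) :
    Set.InjOn (fun i => T i j) (Finset.range (μ.colLen j)) := by
  intro a ha b hb hab
  rw [Finset.mem_coe, Finset.mem_range, ← YoungDiagram.mem_iff_lt_colLen] at ha hb
  rcases lt_trichotomy a b with h | h | h
  · exact absurd hab (T.col_strict h hb).ne
  · exact h
  · exact absurd hab (T.col_strict h ha).ne'

theorem card_colSet (T : SemistandardYoungTableau μ) (j : ℕ) : (colSet T j).card = μ.colLen j := by
  rw [colSet, Finset.card_image_of_injOn (col_injOn T j), Finset.card_range]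

/-- Count the boxes with value in `B` column by column; entries of a column are distinct. -/
theorem sum_content (T : SemistandardYoungTableau μ) (B : Finset ℕ) :
    ∑ k ∈ B, content T k = ∑ j ∈ Finset.range (μ.rowLen 0), (colSet T j ∩ B).card := by
  have h1 : ∑ k ∈ B, content T k = (μ.cells.filter fun c => T c.1 c.2 ∈ B).card := by
    rw [Finset.card_eq_sum_card_fiberwise (f := fun c : ℕ × ℕ => T c.1 c.2) (t := B)]
    · refine Finset.sum_congr rfl fun k hk => ?_
      rw [content, Finset.filter_filter]
      congr 1
      refine Finset.filter_congr fun c _ => ⟨fun h => ⟨h ▸ hk, h⟩, fun h => h.2⟩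
    · intro c hc
      exact (Finset.mem_filter.1 hc).2
  rw [h1, Finset.card_eq_sum_card_fiberwise (f := fun c : ℕ × ℕ => c.2)
    (t := Finset.range (μ.rowLen 0))]
  · refine Finset.sum_congr rfl fun j _ => ?_
    refine Finset.card_bij (fun c _ => T c.1 c.2) ?_ ?_ ?_
    · rintro ⟨a, b⟩ hc
      simp only [Finset.mem_filter, YoungDiagram.mem_cells] at hc
      obtain ⟨⟨hc1, hc2⟩, rfl⟩ := hc
      exact Finset.mem_inter.2 ⟨Finset.mem_image.2
        ⟨a, Finset.mem_range.2 (YoungDiagram.mem_iff_lt_colLen.1 hc1), rfl⟩, hc2⟩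
    · rintro ⟨a, b⟩ hc ⟨a', b'⟩ hc' heq
      simp only [Finset.mem_filter, YoungDiagram.mem_cells] at hc hc' heq
      obtain ⟨⟨hc1, -⟩, rfl⟩ := hc
      obtain ⟨⟨hc1', -⟩, rfl⟩ := hc'
      rw [YoungDiagram.mem_iff_lt_colLen] at hc1 hc1'
      rw [col_injOn T b' (by simpa using hc1) (by simpa using hc1') heq]
    · intro v hv
      obtain ⟨hv1, hv2⟩ := Finset.mem_inter.1 hv
      obtain ⟨i, hi, rfl⟩ := Finset.mem_image.1 hv1
      rw [Finset.mem_range, ← YoungDiagram.mem_iff_lt_colLen] at hi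
      exact ⟨(i, j), by simp [hi, hv2], rfl⟩
  · rintro ⟨a, b⟩ hc
    have hc1 : (a, b) ∈ μ := (YoungDiagram.mem_cells _).1 (Finset.mem_filter.1 hc).1
    have := μ.up_left_mem (Nat.zero_le a) le_rfl hc1
    simpa using YoungDiagram.mem_iff_lt_rowLen.1 this

/-- A tableau with nested columns is the only tableau with its content. -/
theorem eq_of_content_eq {T Y : SemistandardYoungTableau μ} (hY : Y ∈ tableaux n μ)
    (hnest : ∀ j j', j ≤ j' → colSet Y j' ⊆ colSet Y j)
    (h : ∀ k : Fin n, content T k = content Y k) : T = Y := by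
  have hcol : ∀ j, j < μ.rowLen 0 → colSet T j = colSet Y j := by
    intro j hj
    have hsum : ∑ k ∈ colSet Y j, content T k = ∑ k ∈ colSet Y j, content Y k := by
      refine Finset.sum_congr rfl fun k hk => ?_
      obtain ⟨i, hi, rfl⟩ := Finset.mem_image.1 hk
      rw [Finset.mem_range, ← YoungDiagram.mem_iff_lt_colLen] at hi
      exact h ⟨_, hY _ _ hi⟩
    rw [sum_content, sum_content] at hsum
    -- No tableau of this shape can have more values from `colSet Y j` in column `l` than `Y`, since
    -- nestedness makes the intersection one of the two full column sets. Equal totals then force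
    -- equality in every column, in particular in column `j`.
    have hle : ∀ l ∈ Finset.range (μ.rowLen 0),
        (colSet T l ∩ colSet Y j).card ≤ (colSet Y l ∩ colSet Y j).card := by
      intro l _
      rcases le_total l j with hl | hl
      · rw [Finset.inter_eq_right.2 (hnest l j hl)]
        exact Finset.card_le_card Finset.inter_subset_right
      · rw [Finset.inter_eq_left.2 (hnest j l hl), card_colSet, ← card_colSet T]
        exact Finset.card_le_card Finset.inter_subset_left
    have heq := (Finset.sum_eq_sum_iff_of_le hle).1 hsum j (Finset.mem_range.2 hj)
    rw [Finset.inter_self] at heq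
    have hsub : colSet T j ∩ colSet Y j = colSet Y j :=
      Finset.eq_of_subset_of_card_le Finset.inter_subset_right heq.ge
    refine (Finset.eq_of_subset_of_card_le (Finset.inter_eq_right.1 hsub) ?_).symm
    rw [card_colSet, card_colSet]
  refine SemistandardYoungTableau.ext fun i j => ?_
  by_cases hij : (i, j) ∈ μ
  · have hj := YoungDiagram.mem_iff_lt_rowLen.1 (μ.up_left_mem (Nat.zero_le i) le_rfl hij)
    -- A column is the increasing enumeration of its set of values.
    have hemb : ∀ S : SemistandardYoungTableau μ, colSet S j = colSet Y j →
        (fun a : Fin (μ.colLen j) => S a j) =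
          (colSet Y j).orderEmbOfFin (card_colSet Y j) := by
      intro S hS
      refine Finset.orderEmbOfFin_unique _ (fun a => ?_) fun a b hab => ?_
      · rw [← hS]
        exact Finset.mem_image.2 ⟨a, Finset.mem_range.2 a.isLt, rfl⟩
      · exact S.col_strict hab (YoungDiagram.mem_iff_lt_colLen.2 b.isLt)
    have := (hemb T (hcol j hj)).trans (hemb Y rfl).symm
    exact congrFun this ⟨i, YoungDiagram.mem_iff_lt_colLen.1 hij⟩
  · rw [T.zeros hij, Y.zeros hij]

/-- The content of a tableau as an exponent vector. -/
def weight (n : ℕ) (T : SemistandardYoungTableau μ) : Fin n →₀ ℕ :=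
  Finsupp.equivFunOnFinite.symm fun k => content T k

theorem rowBoundSum_eq (β : Fin n → Fin n) :
    rowBoundSum μ β =
      ∑ T ∈ (rowBoundSet_finite μ β).toFinset, MvPolynomial.monomial (weight n T) 1 := by
  refine Finset.sum_congr rfl fun T _ => ?_
  rw [MvPolynomial.monomial_eq, Finsupp.prod_fintype _ _ (by simp)]
  simp [weight]

open Classical in
theorem coeff_rowBoundSum (β : Fin n → Fin n) (d : Fin n →₀ ℕ) :
    MvPolynomial.coeff d (rowBoundSum μ β) =
      (((rowBoundSet_finite μ β).toFinset.filter fun T => weight n T = d).card : ℤ) := by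
  rw [rowBoundSum_eq, MvPolynomial.coeff_sum]
  simp [MvPolynomial.coeff_monomial]

theorem eval_one_rowBoundSum (β : Fin n → Fin n) :
    MvPolynomial.eval (fun _ => 1) (rowBoundSum μ β) =
      ((rowBoundSet_finite μ β).toFinset.card : ℤ) := by
  simp [rowBoundSum]

theorem exists_content_eq_of_rowBoundSum_eq {β β' : Fin n → Fin n}
    (h : rowBoundSum μ β = rowBoundSum μ β') {Y : SemistandardYoungTableau μ}
    (hY : Y ∈ rowBoundSet μ β') :
    ∃ T ∈ rowBoundSet μ β, ∀ k : Fin n, content T k = content Y k := by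
  classical
  have h1 := coeff_rowBoundSum (μ := μ) β (weight n Y)
  rw [h, coeff_rowBoundSum, Nat.cast_inj] at h1
  have h2 : Y ∈ (rowBoundSet_finite μ β').toFinset.filter fun T => weight n T = weight n Y := by
    simp [hY]
  have h3 := Finset.card_pos.2 ⟨Y, h2⟩
  rw [h1] at h3
  obtain ⟨T, hT⟩ := Finset.card_pos.1 h3
  simp only [Finset.mem_filter, Set.Finite.mem_toFinset] at hT
  exact ⟨T, hT.1, fun k => DFunLike.congr_fun hT.2 k⟩

theorem rowBoundSet_eq_of_subset_of_rowBoundSum_eq {β β' : Fin n → Fin n}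
    (h : rowBoundSum μ β = rowBoundSum μ β') (hs : rowBoundSet μ β' ⊆ rowBoundSet μ β) :
    rowBoundSet μ β = rowBoundSet μ β' := by
  have h1 := eval_one_rowBoundSum (μ := μ) β
  rw [h, eval_one_rowBoundSum, Nat.cast_inj] at h1
  have h2 := Finset.eq_of_subset_of_card_le
    (Set.Finite.toFinset_subset_toFinset (hs := rowBoundSet_finite μ β')
      (ht := rowBoundSet_finite μ β) |>.2 hs) h1.ge
  exact (Set.Finite.toFinset_inj.1 h2).symm

end Content

/-! ### Nested key sets of a gapless tuple -/

section KeyChain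

variable {n : ℕ} {R : Set ℕ} {γ : Fin n → Fin n}

/-- For a carrel end `x`: `B` consists of `x + 1` values, the largest of which are the entries of
`γ` in the carrel of `x`. -/
structure IsKeySet (R : Set ℕ) (γ : Fin n → Fin n) (x : Fin n) (B : Finset ℕ) : Prop where
  card : B.card = x + 1
  lt : ∀ v ∈ B, v < n
  mem : ∀ k ≤ x, SameCarrel R k x → (γ k : ℕ) ∈ B
  eq_of_le : ∀ v ∈ B, ∀ i ≤ x, SameCarrel R i x → (γ i : ℕ) ≤ v →
    ∃ k, i ≤ k ∧ k ≤ x ∧ (γ k : ℕ) = v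

theorem apply_le_iff_of_sameCarrel (hγ : γ ∈ UI R) {b x i k : Fin n} (hb : SameCarrel R b x) (hi : b ≤ i)
    (hix : i ≤ x) (hk : b ≤ k) (hkx : k ≤ x) : γ i ≤ γ k ↔ i ≤ k := by
  constructor
  · intro h
    by_contra! hlt
    exact absurd (hγ.2 k i hlt (hb.mono hk hix)) (not_lt.2 h)
  · intro h
    rcases h.eq_or_lt with rfl | h
    · exact le_rfl
    · exact (hγ.2 i k h (hb.mono hi hkx)).le

theorem card_image_Icc (hγ : γ ∈ UI R) {b x : Fin n} (hb : SameCarrel R b x) :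
    ((Finset.Icc b x).image fun k => (γ k : ℕ)).card = x + 1 - b := by
  rw [Finset.card_image_of_injOn, Fin.card_Icc]
  intro i hi k hk hik
  rw [Finset.mem_coe, Finset.mem_Icc] at hi hk
  have hik' : γ i = γ k := Fin.ext hik
  exact le_antisymm ((apply_le_iff_of_sameCarrel hγ hb hi.1 hi.2 hk.1 hk.2).1 hik'.le)
    ((apply_le_iff_of_sameCarrel hγ hb hk.1 hk.2 hi.1 hi.2).1 hik'.ge)

/-- The entry at position `i` of the sorted key set is `γ i`, for `i` in the carrel of `x`. -/
theorem IsKeySet.nth_eq {x : Fin n} {B : Finset ℕ} (hB : IsKeySet R γ x B) (hγ : γ ∈ UI R)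
    {i : Fin n} (hi : i ≤ x) (hc : SameCarrel R i x) : Nat.nth (· ∈ B) i = γ i := by
  -- Of the `x + 1` values of `B`, those at least `γ i` are the `x + 1 - i` entries of `γ` on `[i,
  -- x]`, which leaves `i` smaller ones.
  have hcount : Nat.count (· ∈ B) (γ i) = i := by
    have h1 : (B.filter fun v => (γ i : ℕ) ≤ v) =
        (Finset.Icc i x).image fun k => (γ k : ℕ) := by
      ext v
      simp only [Finset.mem_filter, Finset.mem_image, Finset.mem_Icc]
      constructor
      · rintro ⟨hv, hle⟩
        obtain ⟨k, h1, h2, h3⟩ := hB.eq_of_le v hv i hi hc hle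
        exact ⟨k, ⟨h1, h2⟩, h3⟩
      · rintro ⟨k, ⟨h1, h2⟩, rfl⟩
        exact ⟨hB.mem k h2 (hc.mono h1 le_rfl),
          (apply_le_iff_of_sameCarrel hγ hc le_rfl hi h1 h2).2 h1⟩
    have h2 := Finset.card_filter_add_card_filter_not (s := B) fun v => (γ i : ℕ) ≤ v
    rw [h1, card_image_Icc hγ hc, hB.card] at h2
    have h3 : (B.filter fun v => ¬ (γ i : ℕ) ≤ v) =
        (Finset.range (γ i)).filter fun v => v ∈ B := by
      ext v
      simp [and_comm]
    rw [h3, ← Nat.count_eq_card_filter_range (· ∈ B)] at h2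
    rw [Fin.le_def] at hi
    omega
  have := Nat.nth_count (p := (· ∈ B)) (hB.mem i hi hc)
  rwa [hcount] at this

/-- The first index of the carrel of `x`. -/
theorem exists_carrel_start (x : Fin n) :
    ∃ b ≤ x, SameCarrel R b x ∧ (∀ k, SameCarrel R k x → b ≤ k) ∧
      ((b : ℕ) = 0 ∨ ∃ a : Fin n, (b : ℕ) = a + 1 ∧ (b : ℕ) ∈ R) := by
  classical
  let A := Finset.univ.filter fun k : Fin n => SameCarrel R k x
  have hA : A.Nonempty := ⟨x, by simp [A, SameCarrel.refl]⟩
  have hmin : ∀ k, SameCarrel R k x → A.min' hA ≤ k := fun k hk => A.min'_le k (by simp [A, hk])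
  have hmem : SameCarrel R (A.min' hA) x := by simpa [A] using A.min'_mem hA
  refine ⟨A.min' hA, hmin x (.refl x), hmem, hmin, ?_⟩
  rcases Nat.eq_zero_or_pos (A.min' hA : ℕ) with h0 | h0
  · exact Or.inl h0
  · right
    have hlt := (A.min' hA).isLt
    let a : Fin n := ⟨A.min' hA - 1, by omega⟩
    have ha : (A.min' hA : ℕ) = a + 1 := by simp only [a]; omega
    refine ⟨a, ha, ?_⟩
    rcases isCarrelEnd_or_succ (R := R) a with he | ⟨y, hy, hc⟩
    · rcases he with he | he
      · rwa [ha]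
      · omega
    · have hyb : y = A.min' hA := Fin.ext (by omega)
      have := Fin.le_def.1 (hmin a (hc.trans (hyb ▸ hmem)))
      omega

/-- A set whose values of size at least `γ b` are among the entries of `γ` in the carrel `[b, x]`
extends to a key set. -/
theorem exists_isKeySet_superset (hγ : γ ∈ UI R) {b x : Fin n} (hbx : b ≤ x)
    (hb : SameCarrel R b x) (hmin : ∀ k, SameCarrel R k x → b ≤ k) {P : Finset ℕ}
    (hcard : P.card = b)
    (hP : ∀ v ∈ P, v < γ b ∨ ∃ k, b ≤ k ∧ k ≤ x ∧ (γ k : ℕ) = v) :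
    ∃ B, P ⊆ B ∧ IsKeySet R γ x B := by
  classical
  set C := (Finset.Icc b x).image fun k => (γ k : ℕ) with hC
  have hCcard : C.card = x + 1 - b := card_image_Icc hγ hb
  have hmemC : ∀ v, v ∈ C ↔ ∃ k, b ≤ k ∧ k ≤ x ∧ (γ k : ℕ) = v := by
    intro v
    simp [hC, and_assoc]
  have hdisj : Disjoint (Finset.range (γ b)) C := by
    refine Finset.disjoint_left.2 fun v hv hv' => ?_
    obtain ⟨k, h1, h2, rfl⟩ := (hmemC v).1 hv'
    have := Fin.le_def.1 ((apply_le_iff_of_sameCarrel hγ hb le_rfl hbx h1 h2).2 h1)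
    rw [Finset.mem_range] at hv
    omega
  have hsub : P ∪ C ⊆ Finset.range (γ b) ∪ C := by
    refine Finset.union_subset (fun v hv => ?_) Finset.subset_union_right
    rcases hP v hv with h | h
    · exact Finset.mem_union_left _ (Finset.mem_range.2 h)
    · exact Finset.mem_union_right _ ((hmemC v).2 h)
  have hbγ := Fin.le_def.1 (hγ.1 b)
  rw [Fin.le_def] at hbx
  -- Padding `P ∪ C` only with values below `γ b` keeps `C` as the top part. There is enough room
  -- because `b ≤ γ b`.
  obtain ⟨B, hB1, hB2, hB3⟩ := Finset.exists_subsuperset_card_eq (n := x + 1) hsub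
    ((Finset.card_union_le _ _).trans (by omega))
    (by rw [Finset.card_union_of_disjoint hdisj, Finset.card_range]; omega)
  refine ⟨B, Finset.subset_union_left.trans hB1, hB3, fun v hv => ?_, fun k hk hc => ?_,
    fun v hv i hi hc hle => ?_⟩
  · rcases Finset.mem_union.1 (hB2 hv) with h | h
    · exact (Finset.mem_range.1 h).trans (γ b).isLt
    · obtain ⟨k, -, -, rfl⟩ := (hmemC v).1 h
      exact (γ k).isLt
  · exact hB1 (Finset.mem_union_right _ ((hmemC _).2 ⟨k, hmin k hc, hk, rfl⟩))
  · have hbi := hmin i hc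
    have := Fin.le_def.1 ((apply_le_iff_of_sameCarrel hγ hb le_rfl hbx hbi hi).2 hbi)
    rcases Finset.mem_union.1 (hB2 hv) with h | h
    · rw [Finset.mem_range] at h
      omega
    · obtain ⟨k, h1, h2, rfl⟩ := (hmemC v).1 h
      exact ⟨k, (apply_le_iff_of_sameCarrel hγ hb hbi hi h1 h2).1 (Fin.le_def.2 hle), h2, rfl⟩

/-- The gapless condition lets a key set be extended over the next carrel. -/
theorem IsKeySet.lt_or_exists {a b x : Fin n} {P : Finset ℕ} (hP : IsKeySet R γ a P)
    (hγ : γ ∈ UG R) (hab : (b : ℕ) = a + 1) (hbR : (b : ℕ) ∈ R) (hbx : b ≤ x)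
    (hx : IsCarrelEnd R x) {v : ℕ} (hv : v ∈ P) :
    v < γ b ∨ ∃ k, b ≤ k ∧ k ≤ x ∧ (γ k : ℕ) = v := by
  by_contra! hcon
  obtain ⟨h1, h2⟩ := hcon
  have hva : v ≤ γ a := by
    by_contra! hlt
    obtain ⟨k, hk1, hk2, rfl⟩ := hP.eq_of_le v hv a le_rfl (.refl a) hlt.le
    rw [le_antisymm hk2 hk1] at hlt
    exact lt_irrefl _ hlt
  have hne := h2 b le_rfl hbx
  -- Here `γ b < v ≤ γ a`, the latter because `γ a` is the maximum of `P`; the gapless condition at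
  -- offset `v - γ b` places `v` in the next carrel.
  obtain ⟨k, hk1, hk2, hk3⟩ := hγ.2 a b hab hbR (Fin.lt_def.2 (by omega)) (v - γ b) (by omega)
  have hbk : b ≤ k := Fin.le_def.2 (by omega)
  refine h2 k hbk ?_ (by omega)
  by_contra! hlt
  exact hx.not_sameCarrel hlt (hk2.mono hbx le_rfl)

/-- A gapless tuple has a nested family of key sets. -/
theorem exists_key_chain (hγ : γ ∈ UG R) :
    ∃ B : ℕ → Finset ℕ, ∀ x : Fin n, IsCarrelEnd R x →
      IsKeySet R γ x (B (x + 1)) ∧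
      ∀ y : Fin n, IsCarrelEnd R y → y ≤ x → B (y + 1) ⊆ B (x + 1) := by
  suffices h : ∀ m : ℕ, ∃ B : ℕ → Finset ℕ, ∀ x : Fin n, (x : ℕ) < m → IsCarrelEnd R x →
      IsKeySet R γ x (B (x + 1)) ∧
      ∀ y : Fin n, IsCarrelEnd R y → y ≤ x → B (y + 1) ⊆ B (x + 1) by
    obtain ⟨B, hB⟩ := h n
    exact ⟨B, fun x hx => hB x x.isLt hx⟩
  intro m
  induction m with
  | zero => exact ⟨fun _ => ∅, fun x hx => absurd hx (Nat.not_lt_zero _)⟩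
  | succ m ih =>
    obtain ⟨B, hB⟩ := ih
    by_cases hm : ∃ x : Fin n, (x : ℕ) = m ∧ IsCarrelEnd R x
    swap
    · refine ⟨B, fun x hx he => hB x ?_ he⟩
      have : (x : ℕ) ≠ m := fun h => hm ⟨x, h, he⟩
      omega
    obtain ⟨x, rfl, hx⟩ := hm
    obtain ⟨b, hbx, hb, hmin, hstart⟩ := exists_carrel_start (R := R) x
    -- `P` is the key set of the preceding carrel end, or empty for the first carrel; it contains
    -- all earlier key sets.
    obtain ⟨P, hPcard, hPγ, hPB⟩ : ∃ P : Finset ℕ, P.card = b ∧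
        (∀ v ∈ P, v < γ b ∨ ∃ k, b ≤ k ∧ k ≤ x ∧ (γ k : ℕ) = v) ∧
        ∀ y : Fin n, IsCarrelEnd R y → y < x → B (y + 1) ⊆ P := by
      have hyb : ∀ y : Fin n, IsCarrelEnd R y → y < x → y < b := by
        intro y hy hyx
        by_contra! hle
        exact hy.not_sameCarrel hyx (hb.mono hle le_rfl)
      rcases hstart with h0 | ⟨a, hab, hbR⟩
      · refine ⟨∅, by simp [h0], by simp, fun y hy hyx => ?_⟩
        have := Fin.lt_def.1 (hyb y hy hyx)
        omega
      · have ha : IsCarrelEnd R a := Or.inl (hab ▸ hbR)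
        rw [Fin.le_def] at hbx
        obtain ⟨h1, h2⟩ := hB a (by omega) ha
        refine ⟨B (a + 1), by rw [h1.card, hab],
          fun v hv => h1.lt_or_exists hγ hab hbR hbx hx hv, fun y hy hyx => h2 y hy ?_⟩
        have := Fin.lt_def.1 (hyb y hy hyx)
        exact Fin.le_def.2 (by omega)
    obtain ⟨S, hPS, hS⟩ := exists_isKeySet_superset hγ.1 hbx hb hmin hPcard hPγ
    refine ⟨Function.update B (x + 1) S, fun z hz he => ?_⟩
    rcases (Nat.lt_succ_iff.1 hz).lt_or_eq with hlt | heq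
    · rw [Function.update_of_ne (by omega)]
      obtain ⟨h1, h2⟩ := hB z hlt he
      refine ⟨h1, fun y hy hyz => ?_⟩
      have := Fin.le_def.1 hyz
      rw [Function.update_of_ne (by omega)]
      exact h2 y hy hyz
    · obtain rfl : z = x := Fin.ext heq
      rw [Function.update_self]
      refine ⟨hS, fun y hy hyz => ?_⟩
      rcases hyz.eq_or_lt with rfl | hyz
      · rw [Function.update_self]
      · have := Fin.lt_def.1 hyz
        rw [Function.update_of_ne (by omega)]
        exact (hPB y hy hyz).trans hPS

end KeyChain

/-! ### The key tableau and the comparison of polynomials -/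

section Key

theorem lt_card_toFinset {B : Finset ℕ} {i : ℕ} (hi : i < B.card)
    (hf : (Set.ofPred (· ∈ B)).Finite) : i < hf.toFinset.card := by
  have : hf.toFinset = B := by
    ext v
    simp
  rwa [this]

theorem nth_mem_finset {B : Finset ℕ} {i : ℕ} (hi : i < B.card) : Nat.nth (· ∈ B) i ∈ B :=
  Nat.nth_mem (p := (· ∈ B)) i (lt_card_toFinset hi)

/-- Enlarging a set can only lower its `i`-th smallest element. This gives the weak increase along
rows when the column sets shrink from left to right. -/
theorem nth_anti_of_subset {B B' : Finset ℕ} (h : B ⊆ B') {i : ℕ} (hi : i < B.card) :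
    Nat.nth (· ∈ B') i ≤ Nat.nth (· ∈ B) i := by
  have h1 := nth_mem_finset hi
  have h2 : i ≤ Nat.count (· ∈ B') (Nat.nth (· ∈ B) i) := by
    conv_lhs => rw [← Nat.count_nth (p := (· ∈ B)) (lt_card_toFinset hi)]
    exact Nat.count_mono_left fun k _ hk => h hk
  calc Nat.nth (· ∈ B') i ≤ Nat.nth (· ∈ B') (Nat.count (· ∈ B') (Nat.nth (· ∈ B) i)) :=
        Nat.nth_le_nth' h2 fun hf => Nat.count_lt_card hf (h h1)
    _ = _ := Nat.nth_count (p := (· ∈ B')) (h h1)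

variable {n : ℕ} {μ : YoungDiagram}

/-- For a gapless tuple `γ` there is a tableau whose rows end with the entries of `γ` and which is
determined by its content. -/
theorem exists_key (hμ : μ.colLen 0 ≤ n) {γ : Fin n → Fin n} (hγ : γ ∈ UG (dividers n μ)) :
    ∃ Y : SemistandardYoungTableau μ, (∀ β ∈ U n, Y ∈ rowBoundSet μ β ↔ γ ≤ β) ∧
      ∀ T : SemistandardYoungTableau μ, (∀ k : Fin n, content T k = content Y k) → T = Y := by
  classical
  obtain ⟨B, hB⟩ := exists_key_chain hγ
  have hset : ∀ {i j : ℕ}, (i, j) ∈ μ → (B (μ.colLen j)).card = μ.colLen j ∧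
      ∀ v ∈ B (μ.colLen j), v < n := by
    intro i j h
    obtain ⟨x, hx, -, he⟩ := exists_isCarrelEnd_of_mem hμ h
    obtain ⟨h1, -⟩ := hB x he
    rw [hx] at h1
    exact ⟨h1.card.trans hx, h1.lt⟩
  have hnest : ∀ {i j j' : ℕ}, j ≤ j' → (i, j') ∈ μ → B (μ.colLen j') ⊆ B (μ.colLen j) := by
    intro i j j' hj h
    obtain ⟨y, hy, -, hey⟩ := exists_isCarrelEnd_of_mem hμ h
    obtain ⟨x, hx, -, hex⟩ := exists_isCarrelEnd_of_mem hμ (μ.up_left_mem le_rfl hj h)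
    have := μ.colLen_anti j j' hj
    have := (hB x hex).2 y hey (Fin.le_def.2 (by omega))
    rwa [hx, hy] at this
  have hlt : ∀ {i j : ℕ}, (i, j) ∈ μ → i < (B (μ.colLen j)).card := fun h =>
    (YoungDiagram.mem_iff_lt_colLen.1 h).trans_eq (hset h).1.symm
  -- Column `j` lists in increasing order the key set indexed by its length.
  let e : ℕ → ℕ → ℕ := fun i j => if (i, j) ∈ μ then Nat.nth (· ∈ B (μ.colLen j)) i else 0
  have he : ∀ {i j : ℕ}, (i, j) ∈ μ → e i j = Nat.nth (· ∈ B (μ.colLen j)) i := fun h => by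
    simp [e, h]
  let Y : SemistandardYoungTableau μ :=
    { entry := e
      row_weak' := by
        intro i j1 j2 hj h
        rw [he h, he (μ.up_left_mem le_rfl hj.le h)]
        exact nth_anti_of_subset (hnest hj.le h) (hlt h)
      col_strict' := by
        intro i1 i2 j hi h
        rw [he h, he (μ.up_left_mem hi.le le_rfl h)]
        exact Nat.nth_lt_nth' hi (lt_card_toFinset (hlt h))
      zeros' := fun h => by simp [e, h] }
  have hYe : ∀ i j, Y i j = e i j := fun _ _ => rfl
  have hYmem : ∀ {i j : ℕ}, (i, j) ∈ μ → Y i j ∈ B (μ.colLen j) := fun h => by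
    rw [hYe, he h]
    exact nth_mem_finset (hlt h)
  have hY : Y ∈ tableaux n μ := fun i j h => (hset h).2 _ (hYmem h)
  have hcol : ∀ {i j : ℕ}, (i, j) ∈ μ → colSet Y j = B (μ.colLen j) := by
    intro i j h
    refine Finset.eq_of_subset_of_card_le (fun v hv => ?_) ?_
    · obtain ⟨a, ha, rfl⟩ := Finset.mem_image.1 hv
      exact hYmem (YoungDiagram.mem_iff_lt_colLen.2 (Finset.mem_range.1 ha))
    · rw [card_colSet, (hset h).1]
  refine ⟨Y, fun β hβ => mem_rowBoundSet_iff hY hγ.1 (fun i hi => ?_) hβ, fun T hT =>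
    eq_of_content_eq hY (fun j j' hj => ?_) hT⟩
  · have hmem := rowEnd_mem hi
    obtain ⟨x, hx, hix, hex⟩ := exists_isCarrelEnd_of_mem hμ hmem
    have hc : SameCarrel (dividers n μ) i x := by
      refine (sameCarrel_iff_rowLen (Fin.le_def.2 hix)).2 ?_
      have h1 := μ.rowLen_anti i x hix
      have h2 := YoungDiagram.mem_iff_lt_rowLen.1 (YoungDiagram.mem_iff_lt_colLen.2
        (show (x : ℕ) < μ.colLen (μ.rowLen i - 1) by omega))
      omega
    rw [hYe, he hmem, ← hx]
    exact (hB x hex).1.nth_eq hγ.1 (Fin.le_def.2 hix) hc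
  · intro v hv
    obtain ⟨a, ha, -⟩ := Finset.mem_image.1 hv
    have h := YoungDiagram.mem_iff_lt_colLen.2 (Finset.mem_range.1 ha)
    rw [hcol h] at hv
    rw [hcol (μ.up_left_mem le_rfl hj h)]
    exact hnest hj h hv

/-- A row bound sum that equals a gapless core Schur polynomial has the same set of tableaux. -/
theorem rowBoundSet_eq_of_rowBoundSum_eq (hμ : μ.colLen 0 ≤ n) {β η : Fin n → Fin n}
    (hβ : β ∈ U n) (hη : η ∈ UGC (dividers n μ)) (h : rowBoundSum μ β = rowBoundSum μ η) :
    rowBoundSet μ β = rowBoundSet μ η := by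
  obtain ⟨Y, hY, huniq⟩ := exists_key hμ hη.2
  obtain ⟨T, hT, hcont⟩ := exists_content_eq_of_rowBoundSum_eq h
    ((hY η hη.1).2 (core_le hη.1))
  rw [huniq T hcont] at hT
  exact rowBoundSet_eq_of_subset_of_rowBoundSum_eq h
    (rowBoundSet_subset hη.1 hβ ((hY β hβ).1 hT))

theorem rowBoundSum_eq_iff_core_eq (hμ : μ.colLen 0 ≤ n) {β η : Fin n → Fin n}
    (hβ : β ∈ U n) (hη : η ∈ UGC (dividers n μ)) :
    rowBoundSum μ β = rowBoundSum μ η ↔ core (dividers n μ) β = core (dividers n μ) η := by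
  constructor
  · intro h
    exact (sim_iff hβ hη.1).1
      (sim_of_rowBoundSet_eq hμ hβ hη.1 (rowBoundSet_eq_of_rowBoundSum_eq hμ hβ hη h))
  · intro h
    simp only [rowBoundSum, rowBoundSet_eq_of_core_eq hβ hη.1 h]

end Key

end RowBound

end

/-! ### Assembly: both families of intervals are the fibres of the core -/

theorem mainTheorem9 (n : ℕ) (hn : 1 ≤ n) (μ : YoungDiagram) (hμ : μ.colLen 0 ≤ n)
    (R : Set ℕ) (hR : R = RowBound.dividers n μ) :
    -- no accidental equality between a row bound sum and a gapless core Schur polynomial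
    (∀ β ∈ RowBound.U n, ∀ η ∈ RowBound.UGC (n := n) R,
      RowBound.rowBoundSum μ β = RowBound.rowBoundSum μ η →
        RowBound.Sim R β η ∧ RowBound.core R β = RowBound.core R η ∧
        β ∈ RowBound.UGC R ∧ RowBound.rowBoundSet μ β = RowBound.rowBoundSet μ η) ∧
    -- gapless core Schur polynomials: the class intervals describe all coincidences
    (RowBound.IsPartitionOf
        {B | ∃ η ∈ RowBound.UGC (n := n) R,
          B = RowBound.UGC R ∩ Set.Icc (RowBound.core R η) (RowBound.canopy R η)}
        (RowBound.UGC (n := n) R) ∧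
      ∀ η ∈ RowBound.UGC (n := n) R,
        IsLeast (RowBound.classIn (RowBound.UGC R) R η) (RowBound.core R η) ∧
        IsGreatest (RowBound.classIn (RowBound.UGC R) R η) (RowBound.canopy R η) ∧
        RowBound.classIn (RowBound.UGC R) R η =
          RowBound.UGC R ∩ Set.Icc (RowBound.core R η) (RowBound.canopy R η) ∧
        RowBound.classIn (RowBound.U n) R η =
          RowBound.U n ∩ Set.Icc (RowBound.core R η) (RowBound.canopy R η) ∧
        RowBound.classIn (RowBound.UGC R) R η = RowBound.classIn (RowBound.U n) R η ∧
        (∀ β ∈ RowBound.U n, RowBound.rowBoundSum μ β = RowBound.rowBoundSum μ η ↔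
          β ∈ Set.Icc (RowBound.core R η) (RowBound.canopy R η)) ∧
        (∀ η' ∈ RowBound.UGC R, RowBound.rowBoundSum μ η' = RowBound.rowBoundSum μ η ↔
          η' ∈ Set.Icc (RowBound.core R η) (RowBound.canopy R η))) ∧
    -- flag Schur polynomials: the class intervals describe all coincidences
    (RowBound.IsPartitionOf
        {B | ∃ φ ∈ RowBound.UF n,
          B = RowBound.UF n ∩ Set.Icc (RowBound.floor R φ) (RowBound.ceiling R φ)}
        (RowBound.UF n) ∧
      ∀ φ ∈ RowBound.UF n,
        φ ∈ RowBound.UGC R ∧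
        IsLeast (RowBound.classIn (RowBound.UF n) R φ) (RowBound.floor R φ) ∧
        IsGreatest (RowBound.classIn (RowBound.UF n) R φ) (RowBound.ceiling R φ) ∧
        RowBound.classIn (RowBound.UF n) R φ =
          RowBound.UF n ∩ Set.Icc (RowBound.floor R φ) (RowBound.ceiling R φ) ∧
        (∀ φ' ∈ RowBound.UF n, RowBound.rowBoundSum μ φ' = RowBound.rowBoundSum μ φ ↔
          φ' ∈ Set.Icc (RowBound.floor R φ) (RowBound.ceiling R φ))) := by
  subst hR
  have hUGC : RowBound.UGC (n := n) (RowBound.dividers n μ) ⊆ RowBound.U n := fun _ h => h.1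
  have hUF : RowBound.UF n ⊆ RowBound.U n := fun _ h => h.1
  have hmem : ∀ {β η : Fin n → Fin n}, β ∈ RowBound.U n → η ∈ RowBound.UGC (RowBound.dividers n μ) →
      RowBound.core (RowBound.dividers n μ) β = RowBound.core (RowBound.dividers n μ) η →
      β ∈ RowBound.UGC (RowBound.dividers n μ) := fun hβ hη h => ⟨hβ, h ▸ hη.2⟩
  have hclass : ∀ η ∈ RowBound.UGC (n := n) (RowBound.dividers n μ),
      RowBound.UGC (RowBound.dividers n μ) ∩ Set.Icc (RowBound.core (RowBound.dividers n μ) η)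
        (RowBound.canopy (RowBound.dividers n μ) η) =
      {η' | η' ∈ RowBound.UGC (RowBound.dividers n μ) ∧
        RowBound.core (RowBound.dividers n μ) η' = RowBound.core (RowBound.dividers n μ) η} :=
    fun η hη => Set.ext fun η' => and_congr_right fun h =>
      (RowBound.core_eq_iff_mem_Icc hη.1 h.1).symm
  have hclassF : ∀ φ ∈ RowBound.UF n,
      RowBound.UF n ∩ Set.Icc (RowBound.floor (RowBound.dividers n μ) φ)
        (RowBound.ceiling (RowBound.dividers n μ) φ) =
      {φ' | φ' ∈ RowBound.UF n ∧
        RowBound.core (RowBound.dividers n μ) φ' = RowBound.core (RowBound.dividers n μ) φ} :=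
    fun φ hφ => Set.ext fun φ' => and_congr_right fun h =>
      (RowBound.core_eq_iff_mem_Icc_of_mem_UF hφ h).symm
  refine ⟨fun β hβ η hη h => ?_, ⟨RowBound.isPartitionOf_fibers _ _ _ hclass, fun η hη => ?_⟩,
    RowBound.isPartitionOf_fibers _ _ _ hclassF, fun φ hφ => ?_⟩
  · have hcore := (RowBound.rowBoundSum_eq_iff_core_eq hμ hβ hη).1 h
    exact ⟨(RowBound.sim_iff hβ hη.1).2 hcore, hcore, hmem hβ hη hcore,
      RowBound.rowBoundSet_eq_of_core_eq hβ hη.1 hcore⟩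
  · have h1 := RowBound.classIn_eq (R := RowBound.dividers n μ) hUGC hη.1
    have h2 := RowBound.classIn_eq (R := RowBound.dividers n μ) subset_rfl hη.1
    have hiff : ∀ β ∈ RowBound.U n, RowBound.rowBoundSum μ β = RowBound.rowBoundSum μ η ↔
        β ∈ Set.Icc (RowBound.core (RowBound.dividers n μ) η)
          (RowBound.canopy (RowBound.dividers n μ) η) := fun β hβ =>
      (RowBound.rowBoundSum_eq_iff_core_eq hμ hβ hη).trans
        (RowBound.core_eq_iff_mem_Icc hη.1 hβ)
    have hcore := RowBound.core_core (R := RowBound.dividers n μ) hη.1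
    have hcan := RowBound.core_canopy (R := RowBound.dividers n μ) hη.1
    refine ⟨?_, ?_, h1.trans (hclass η hη).symm, ?_, ?_, hiff, fun η' hη' => hiff η' hη'.1⟩
    · rw [h1]
      exact ⟨⟨hmem (RowBound.core_mem_UI hη.1).1 hη hcore, hcore⟩,
        fun η' h => h.2 ▸ RowBound.core_le h.1.1⟩
    · rw [h1]
      exact ⟨⟨hmem (RowBound.canopy_mem_U hη.1) hη hcan, hcan⟩,
        fun η' h => ((RowBound.core_eq_iff_mem_Icc hη.1 h.1.1).1 h.2).2⟩
    · rw [h2]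
      exact Set.ext fun β => and_congr_right fun h => RowBound.core_eq_iff_mem_Icc hη.1 h
    · rw [h1, h2]
      exact Set.ext fun β => ⟨fun h => ⟨h.1.1, h.2⟩, fun h => ⟨hmem h.1 hη h.2, h.2⟩⟩
  · have hG := RowBound.mem_UGC_of_mem_UF (R := RowBound.dividers n μ) hφ
    have h1 := RowBound.classIn_eq (R := RowBound.dividers n μ) hUF hφ.1
    refine ⟨hG, ?_, ?_, h1.trans (hclassF φ hφ).symm, fun φ' hφ' =>
      (RowBound.rowBoundSum_eq_iff_core_eq hμ hφ'.1 hG).trans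
        (RowBound.core_eq_iff_mem_Icc_of_mem_UF hφ hφ')⟩
    · rw [h1]
      exact ⟨⟨RowBound.floor_mem_UF hφ, RowBound.core_floor hφ⟩,
        fun φ' h => RowBound.floor_le_of_core_eq hφ h.1 h.2⟩
    · rw [h1]
      exact ⟨⟨RowBound.ceiling_mem_UF hφ, RowBound.core_ceiling hφ⟩,
        fun φ' h => RowBound.le_ceiling_of_core_eq hφ h.1 h.2⟩
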